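/- For a positive integer $d$ let $T(d)$ denote the length of the minimal positive period of the simple continued fraction expansion of $\sqrt d$ if $d$ is not a perfect square, and let $T(d)=0$ if $d$ is a perfect square. Then for every real $x>1$ $$\sum_{d\le x} T(d)\le c_1x^{3/2}\qquad\text{and}\qquad \sum_{d\le x} T(d)^2\le 11.9\,x^2+5\,x^{3/2}\log^2(4e^4x),$$ where $c_1=\frac43\log 2$. Moreover, as $x\to\infty$, $$\sum_{x<d\le 2x} T(d)\le c_2x^{3/2}+O(\sqrt x)\qquad\text{and}\qquad \sum_{x<d\le 2x} T(d)^2\le 47\,x^2+O(x^{3/2}\log^2x),$$ where $c_2=\frac{8\sqrt2-4}{3}\log 2$. All sums run over positive integers $d$. -/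

import Mathlib

open Filter Asymptotics

/-- `p` is a (positive) period of the simple continued fraction expansion of the real number `v`:
from some index on, the partial denominators repeat with step `p`. -/
def IsContFracPeriod (v : ℝ) (p : ℕ) : Prop :=
  0 < p ∧ ∃ N : ℕ, ∀ n ≥ N,
    (GenContFract.of v).partDens.get? (n + p) = (GenContFract.of v).partDens.get? n

open Classical in
/-- `sqrtPeriod d` is the length `T(d)` of the minimal positive period of the simple continued
fraction expansion of `√d` if `d` is not a square, and `0` if `d` is a square. -/
noncomputable def sqrtPeriod (d : ℕ) : ℕ :=
  if IsSquare d then 0 else sInf {p : ℕ | IsContFracPeriod (Real.sqrt d) p}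

/-! Every complete quotient of √d after √d itself has the form (P + √d)/Q, exceeds 1, and has
conjugate in (-1, 0). With R = (d - P²)/Q > 0 this says |Q - R| < 2P, and Q, R are never both even.
There are finitely many such triples, so two complete quotients coincide and T(d) is at most the
number of triples (`sqrtPeriod_le_card_reducedTriples`). All four bounds follow by counting triples;
log 2 enters only through numerical comparison.

First moment: summing over d ≤ r² counts lattice points. For fixed P and v = |Q - R| < 2P, the
number m = min(Q, R) satisfies m(m + v) ≤ r² - P², and m must be odd when v is even. The largest
real m is convex in v, so a chord bounds it above and a tangent below. Summing the resulting
polynomials puts the total between 5/8·r³ and 25/32·r³ up to O(r²), which suffices for c₁ and c₂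
once small r is checked separately.

Second moment: a triple with Q ≤ R is determined by Q and the root P mod Q of a² ≡ d (mod Q).
Squaring the count gives pairs of moduli A, B ≤ √X. For each pair of residues, d lies in at most one
class modulo lcm(A, B), and the compatible pairs are counted by factoring a² - b² modulo gcd(A, B).
The total is at most 10X², with no logarithms. -/

/-! ### Reduced quadratic irrationals and the Gauss map -/

/-- `(P, Q, R)` encodes the reduced quadratic irrational `(P + √d) / Q` with `P ^ 2 + Q * R = d`,
with `Q` and `R` not both even. -/
def IsReducedTriple (d P Q R : ℕ) : Prop :=
  0 < Q ∧ 0 < R ∧ P ^ 2 + Q * R = d ∧ Q < R + 2 * P ∧ R < Q + 2 * P ∧ ¬(2 ∣ Q ∧ 2 ∣ R)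

instance (d P Q R : ℕ) : Decidable (IsReducedTriple d P Q R) := by
  unfold IsReducedTriple; infer_instance

/-- The finite set of all reduced triples for `d`. -/
def reducedTriples (d : ℕ) : Finset (ℕ × ℕ × ℕ) :=
  (Finset.range (d + 1) ×ˢ Finset.range (d + 1) ×ˢ Finset.range (d + 1)).filter
    fun t => IsReducedTriple d t.1 t.2.1 t.2.2

lemma mem_reducedTriples {d : ℕ} {t : ℕ × ℕ × ℕ} :
    t ∈ reducedTriples d ↔ IsReducedTriple d t.1 t.2.1 t.2.2 := by
  obtain ⟨P, Q, R⟩ := t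
  simp only [reducedTriples, Finset.mem_filter, Finset.mem_product, Finset.mem_range,
    and_iff_right_iff_imp]
  rintro ⟨hQ, hR, h, -⟩
  refine ⟨?_, ?_, ?_⟩
  · nlinarith [Nat.zero_le P]
  · nlinarith [Nat.zero_le (P ^ 2)]
  · nlinarith [Nat.zero_le (P ^ 2)]

lemma exists_reducedTriple_of_int {d : ℕ} {P Q R : ℤ} (hP : 0 < P) (hQ : 0 < Q) (hR : 0 < R)
    (h : P ^ 2 + Q * R = d) (h₁ : Q < R + 2 * P) (h₂ : R < Q + 2 * P)
    (h₃ : ¬(2 ∣ Q ∧ 2 ∣ R)) :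
    ∃ p q r : ℕ, IsReducedTriple d p q r ∧ (p : ℤ) = P ∧ (q : ℤ) = Q := by
  lift P to ℕ using hP.le
  lift Q to ℕ using hQ.le
  lift R to ℕ using hR.le
  refine ⟨P, Q, R, ⟨by exact_mod_cast hQ, by exact_mod_cast hR, by exact_mod_cast h,
    by exact_mod_cast h₁, by exact_mod_cast h₂, ?_⟩, rfl, rfl⟩
  exact_mod_cast h₃

/-- The Gauss map sends a reduced quadratic irrational to a reduced one. -/
lemma IsReducedTriple.exists_inv_fract {d P Q R : ℕ} (hd : ¬IsSquare d)
    (h : IsReducedTriple d P Q R) :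
    ∃ p q r : ℕ, IsReducedTriple d p q r ∧
      (Int.fract ((P + Real.sqrt d) / Q))⁻¹ = (p + Real.sqrt d) / q := by
  obtain ⟨hQ, hR, hd', h1, h2, h3⟩ := h
  set s := Real.sqrt d with hs
  have hs2 : s ^ 2 = d := Real.sq_sqrt (Nat.cast_nonneg d)
  have hs0 : 0 ≤ s := Real.sqrt_nonneg _
  set b : ℤ := ⌊((P : ℝ) + s) / Q⌋ with hb
  have hQr : (0 : ℝ) < Q := by exact_mod_cast hQ
  have hRr : (0 : ℝ) < R := by exact_mod_cast hR
  have hdr : (P : ℝ) ^ 2 + Q * R = s ^ 2 := by rw [hs2]; exact_mod_cast hd'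
  have h1r : (Q : ℝ) < R + 2 * P := by exact_mod_cast h1
  have h2r : (R : ℝ) < Q + 2 * P := by exact_mod_cast h2
  have hPs : (P : ℝ) < s := by
    apply lt_of_pow_lt_pow_left₀ 2 hs0
    nlinarith [mul_pos hQr hRr]
  -- Multiplied by Q, the inequality Q < R + 2P reads (Q - P)² < d; hence (P + √d)/Q > 1.
  have hQPs : (Q : ℝ) - P < s := by
    apply lt_of_pow_lt_pow_left₀ 2 hs0
    nlinarith [mul_lt_mul_of_pos_left h1r hQr]
  have hb1 : 1 ≤ b := by
    rw [hb, Int.le_floor, le_div_iff₀ hQr]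
    push_cast; linarith
  have hb1r : (1 : ℝ) ≤ b := by exact_mod_cast hb1
  have hbl : (b : ℝ) * Q ≤ P + s := by
    rw [← le_div_iff₀ hQr]; exact Int.floor_le _
  have hbu : P + s < ((b : ℝ) + 1) * Q := by
    rw [← div_lt_iff₀ hQr]; exact Int.lt_floor_add_one _
  -- Rationalizing 1/((P + √d)/Q - b) gives (P₁ + √d)/Q₁ with Q₁Q = d - P₁², so the next triple is
  -- (P₁, Q₁, Q).
  set P₁ : ℤ := b * Q - P with hP₁
  set Q₁ : ℤ := R - b ^ 2 * Q + 2 * b * P with hQ₁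
  have hP₁r : (P₁ : ℝ) = b * Q - P := by rw [hP₁]; push_cast; ring
  have hQ₁r : (Q₁ : ℝ) = R - b ^ 2 * Q + 2 * b * P := by rw [hQ₁]; push_cast; ring
  have hprod : (Q₁ : ℝ) * Q = s ^ 2 - P₁ ^ 2 := by rw [hP₁r, hQ₁r, ← hdr]; ring
  have hA : s < P₁ + Q := by rw [hP₁r]; linarith
  have hB : (Q : ℝ) < s + P₁ := by
    rw [hP₁r]; nlinarith [mul_nonneg (sub_nonneg.2 hb1r) hQr.le]
  have hP₁pos : (0 : ℝ) < P₁ := by linarith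
  have hP₁s : (P₁ : ℝ) < s := by
    -- Strictness is where d must not be a square.
    refine lt_of_le_of_ne (by rw [hP₁r]; linarith) fun heq => hd ?_
    have : (P₁ : ℝ) ^ 2 = (d : ℝ) := by rw [heq, hs2]
    have h' : P₁ ^ 2 = (d : ℤ) := by exact_mod_cast this
    refine ⟨P₁.natAbs, ?_⟩
    zify
    rw [← h', ← sq, sq_abs]
  have hQ₁pos : (0 : ℝ) < Q₁ := by
    by_contra hneg
    push Not at hneg
    nlinarith [mul_nonneg (neg_nonneg.2 hneg) hQr.le,
      mul_pos (sub_pos.2 hP₁s) (add_pos hP₁pos hP₁pos)]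
  have hi1 : (Q₁ : ℝ) < Q + 2 * P₁ := by
    refine lt_of_mul_lt_mul_right ?_ hQr.le
    nlinarith
  have hi2 : (Q : ℝ) < Q₁ + 2 * P₁ := by
    refine lt_of_mul_lt_mul_right ?_ hQr.le
    have : ((Q : ℝ) - P₁) ^ 2 < s ^ 2 := by
      apply sq_lt_sq'
      · linarith
      · linarith
    nlinarith
  obtain ⟨p, q, r, hpqr, hp, hq⟩ := exists_reducedTriple_of_int (d := d) (P := P₁) (Q := Q₁)
    (R := Q) (by exact_mod_cast hP₁pos) (by exact_mod_cast hQ₁pos) (by exact_mod_cast hQ)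
    (by have : (P₁ : ℝ) ^ 2 + Q₁ * Q = (d : ℝ) := by rw [hprod, ← hs2]; ring
        exact_mod_cast this)
    (by exact_mod_cast hi1) (by exact_mod_cast hi2)
    (by
      -- If Q is even then Q₁ ≡ R (mod 2), so evenness of both Q₁ and Q would pass back to Q and R.
      rintro ⟨⟨u, hu⟩, w, hw⟩
      refine h3 ⟨by omega, ?_⟩
      have : (2 : ℤ) ∣ R := ⟨u + b ^ 2 * w - b * P, by
        have : (R : ℤ) = Q₁ + b ^ 2 * Q - 2 * b * P := by rw [hQ₁]; ring
        rw [this, hu, hw]; ring⟩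
      exact_mod_cast this)
  refine ⟨p, q, r, hpqr, ?_⟩
  have hpr : (p : ℝ) = P₁ := by exact_mod_cast hp
  have hqr : (q : ℝ) = Q₁ := by exact_mod_cast hq
  have hfr : Int.fract (((P : ℝ) + s) / Q) = (s - P₁) / Q := by
    rw [← Int.self_sub_floor, ← hb, hP₁r]; field_simp; ring
  rw [hfr, hpr, hqr, inv_div, div_eq_div_iff (by linarith) hQ₁pos.ne']
  linear_combination hprod

/-- √d itself is not reduced, but 1/(√d - a) with a = ⌊√d⌋ is; its triple (a, d - a², 1) has R odd.
-/
lemma exists_reducedTriple_inv_fract_sqrt {d : ℕ} (hd : ¬IsSquare d) :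
    ∃ p q r : ℕ, IsReducedTriple d p q r ∧
      (Int.fract (Real.sqrt d))⁻¹ = (p + Real.sqrt d) / q := by
  have h1 : Nat.sqrt d * Nat.sqrt d < d :=
    lt_of_le_of_ne (Nat.sqrt_le d) fun h => hd ⟨_, h.symm⟩
  have h2 : d < (Nat.sqrt d + 1) * (Nat.sqrt d + 1) := Nat.lt_succ_sqrt d
  set a := Nat.sqrt d
  have ha : 0 < a := by
    by_contra h0
    have : a = 0 := by omega
    rw [this] at h1 h2
    omega
  refine ⟨a, d - a * a, 1, ⟨by omega, one_pos, by rw [sq]; omega, ?_, by omega, by omega⟩, ?_⟩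
  · have : (a + 1) * (a + 1) = a * a + 2 * a + 1 := by ring
    omega
  · have hs2 : Real.sqrt d ^ 2 = d := Real.sq_sqrt (Nat.cast_nonneg d)
    have hfl : ⌊Real.sqrt d⌋ = (a : ℤ) := by
      rw [Int.floor_eq_iff]
      constructor
      · exact Real.le_sqrt_of_sq_le (by rw [sq]; exact_mod_cast h1.le)
      · rw [Real.sqrt_lt' (by positivity), sq]; exact_mod_cast h2
    have h1r : (a : ℝ) * a < d := by exact_mod_cast h1
    have hlt : (a : ℝ) < Real.sqrt d := Real.lt_sqrt_of_sq_lt (by rw [sq]; exact h1r)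
    rw [← Int.self_sub_floor, hfl, Nat.cast_sub h1.le, inv_eq_one_div]
    push_cast
    rw [div_eq_div_iff (by linarith) (by linarith)]
    linear_combination -hs2

/-! ### Complete quotients and the bound for the period -/

/-- The map sending a complete quotient of a continued fraction to the next one. -/
noncomputable def gaussMap (v : ℝ) : ℝ := (Int.fract v)⁻¹

lemma s_get?_iterate_gaussMap (v : ℝ) (m n : ℕ) :
    (GenContFract.of (gaussMap^[m] v)).s.get? n = (GenContFract.of v).s.get? (n + m) := by
  induction m generalizing v with
  | zero => rfl
  | succ m ih =>
    rw [Function.iterate_succ_apply, ih, ← add_assoc, GenContFract.of_s_succ]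
    rfl

lemma isContFracPeriod_of_iterate_eq {v : ℝ} {i j : ℕ} (hij : i < j)
    (h : gaussMap^[i] v = gaussMap^[j] v) : IsContFracPeriod v (j - i) := by
  refine ⟨by omega, i, fun n hn => ?_⟩
  have : (GenContFract.of v).s.get? (n + (j - i)) = (GenContFract.of v).s.get? n := by
    have h1 := s_get?_iterate_gaussMap v i (n - i)
    have h2 := s_get?_iterate_gaussMap v j (n - i)
    rw [show n - i + i = n by omega] at h1
    rw [show n - i + j = n + (j - i) by omega] at h2
    rw [← h1, ← h2, h]
  simp only [GenContFract.partDens, Stream'.Seq.map_get?, this]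

/-- The period length of `√d` is at most the number of reduced triples. -/
theorem sqrtPeriod_le_card_reducedTriples (d : ℕ) :
    sqrtPeriod d ≤ (reducedTriples d).card := by
  classical
  unfold sqrtPeriod
  split_ifs with hd
  · exact Nat.zero_le _
  have key : ∀ n : ℕ, ∃ t ∈ reducedTriples d,
      gaussMap^[n + 1] (Real.sqrt d) = (t.1 + Real.sqrt d) / t.2.1 := by
    intro n
    induction n with
    | zero =>
      obtain ⟨p, q, r, h, he⟩ := exists_reducedTriple_inv_fract_sqrt hd
      exact ⟨(p, q, r), mem_reducedTriples.2 h, he⟩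
    | succ n ih =>
      obtain ⟨t, ht, he⟩ := ih
      obtain ⟨p, q, r, h, he'⟩ := (mem_reducedTriples.1 ht).exists_inv_fract hd
      refine ⟨(p, q, r), mem_reducedTriples.2 h, ?_⟩
      rw [Function.iterate_succ_apply', he]
      exact he'
  choose t ht he using key
  -- Pigeonhole on one more complete quotient than there are triples. A repetition gives eventual
  -- periodicity, which is all that `IsContFracPeriod` asks.
  obtain ⟨i, hi, j, hj, hij, hteq⟩ := Finset.exists_ne_map_eq_of_card_lt_of_maps_to
    (s := Finset.range ((reducedTriples d).card + 1)) (t := reducedTriples d) (f := t)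
    (by simp) (fun n _ => ht n)
  simp only [Finset.mem_range] at hi hj
  have main : ∀ i j : ℕ, i < j → j < (reducedTriples d).card + 1 → t i = t j →
      sInf {p : ℕ | IsContFracPeriod (Real.sqrt d) p} ≤ (reducedTriples d).card := by
    intro i j hij hj hteq
    have heq : gaussMap^[i + 1] (Real.sqrt d) = gaussMap^[j + 1] (Real.sqrt d) := by
      rw [he, he, hteq]
    exact (Nat.sInf_le (isContFracPeriod_of_iterate_eq (by omega) heq)).trans (by omega)
  rcases lt_or_gt_of_ne hij with h | h
  · exact main i j h hj hteq
  · exact main j i h hi hteq.symm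

/-! ### Reduced triples as lattice points -/

lemma sum_Ioo_natAbs (f : ℕ → ℕ) (k : ℕ) :
    ∑ u ∈ Finset.Ioo (-(k + 1 : ℤ)) (k + 1), f u.natAbs
      = f 0 + 2 * ∑ v ∈ Finset.Ico 1 (k + 1), f v := by
  induction k with
  | zero =>
    have : Finset.Ioo (-((0 : ℕ) + 1 : ℤ)) ((0 : ℕ) + 1) = {0} := by
      ext u; simp only [Finset.mem_Ioo, Finset.mem_singleton]; omega
    rw [this]; simp
  | succ k ih =>
    have : Finset.Ioo (-((k + 1 : ℕ) + 1 : ℤ)) ((k + 1 : ℕ) + 1)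
        = insert ((k : ℤ) + 1) (insert (-((k : ℤ) + 1)) (Finset.Ioo (-(k + 1 : ℤ)) (k + 1))) := by
      ext u; simp only [Finset.mem_Ioo, Finset.mem_insert]; omega
    rw [this, Finset.sum_insert, Finset.sum_insert, ih,
      Finset.sum_Ico_succ_top (show 1 ≤ k + 1 by omega)]
    · have h1 : ((k : ℤ) + 1).natAbs = k + 1 := by omega
      have h2 : (-((k : ℤ) + 1)).natAbs = k + 1 := by omega
      rw [h1, h2]; ring
    · simp
    · simp only [Finset.mem_insert, Finset.mem_Ioo]; omega

/-- The values `m = min Q R` for the reduced triples `(P, Q, R)` with `|Q - R| = v` and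
`P ^ 2 + Q * R ≤ X`. -/
def minValues (X P v : ℕ) : Finset ℕ :=
  (Finset.Icc 1 X).filter fun m => P ^ 2 + m * (m + v) ≤ X ∧ ¬(2 ∣ v ∧ 2 ∣ m)

lemma mem_minValues {X P v m : ℕ} :
    m ∈ minValues X P v ↔ 1 ≤ m ∧ P ^ 2 + m * (m + v) ≤ X ∧ ¬(2 ∣ v ∧ 2 ∣ m) := by
  simp only [minValues, Finset.mem_filter, Finset.mem_Icc]
  refine ⟨fun h => ⟨h.1.1, h.2⟩, fun h => ⟨⟨h.1, ?_⟩, h.2⟩⟩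
  nlinarith [h.1, h.2.1, Nat.zero_le (P ^ 2), Nat.zero_le (m * v)]

/-- The coordinates (P, Q - R, min Q R) determine the triple and d, and turn reducedness into |u| <
2P. -/
lemma sum_card_reducedTriples_eq_sum_int (X : ℕ) :
    ∑ d ∈ Finset.Icc 1 X, (reducedTriples d).card
      = ∑ P ∈ Finset.Icc 1 (Nat.sqrt X), ∑ u ∈ Finset.Ioo (-(2 * P : ℤ)) (2 * P),
          (minValues X P u.natAbs).card := by
  simp_rw [← Finset.card_sigma]
  refine Finset.card_bij'
    (fun t _ => (⟨t.2.1, ⟨(t.2.2.1 : ℤ) - t.2.2.2, min t.2.2.1 t.2.2.2⟩⟩ : Σ _ : ℕ, Σ _ : ℤ, ℕ))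
    (fun t _ => (⟨t.1 ^ 2 + (t.2.2 + t.2.1.toNat) * (t.2.2 + (-t.2.1).toNat),
      (t.1, t.2.2 + t.2.1.toNat, t.2.2 + (-t.2.1).toNat)⟩ : Σ _ : ℕ, ℕ × ℕ × ℕ)) ?_ ?_ ?_ ?_
  · rintro ⟨d, P, Q, R⟩ h
    simp only [Finset.mem_sigma, Finset.mem_Icc, mem_reducedTriples] at h
    obtain ⟨⟨hd1, hdX⟩, hQ, hR, hd, h1, h2, h3⟩ := h
    simp only [Finset.mem_sigma, Finset.mem_Icc, Finset.mem_Ioo, mem_minValues]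
    refine ⟨⟨by omega, ?_⟩, ⟨by omega, by omega⟩, by omega, ?_, ?_⟩
    · rw [Nat.le_sqrt']; nlinarith [Nat.zero_le (Q * R)]
    · rcases le_total Q R with h | h
      · rw [min_eq_left h, show Q + ((Q : ℤ) - R).natAbs = R by omega]; omega
      · rw [min_eq_right h, show R + ((Q : ℤ) - R).natAbs = Q by omega, mul_comm R Q]; omega
    · rcases le_total Q R with h | h
      · rw [min_eq_left h]; omega
      · rw [min_eq_right h]; omega
  · rintro ⟨P, u, m⟩ h
    simp only [Finset.mem_sigma, Finset.mem_Icc, Finset.mem_Ioo, mem_minValues] at h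
    obtain ⟨⟨hP, hPX⟩, ⟨hu1, hu2⟩, hm, hle, hpar⟩ := h
    simp only [Finset.mem_sigma, Finset.mem_Icc, mem_reducedTriples, IsReducedTriple]
    have hprod : (m + u.toNat) * (m + (-u).toNat) = m * (m + u.natAbs) := by
      rcases le_total 0 u with h | h
      · rw [show (-u).toNat = 0 by omega, show u.toNat = u.natAbs by omega]; ring
      · rw [show (-u).toNat = u.natAbs by omega, show u.toNat = 0 by omega]; ring
    rw [hprod]
    refine ⟨⟨?_, hle⟩, by omega, by omega, trivial, by omega, by omega, by omega⟩
    nlinarith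
  · rintro ⟨d, P, Q, R⟩ h
    simp only [Finset.mem_sigma, Finset.mem_Icc, mem_reducedTriples] at h
    obtain ⟨-, hQ, hR, hd, -⟩ := h
    have h1 : min Q R + ((Q : ℤ) - R).toNat = Q := by omega
    have h2 : min Q R + (-((Q : ℤ) - R)).toNat = R := by omega
    simp only [h1, h2, hd]
  · rintro ⟨P, u, m⟩ h
    have h1 : (((m + u.toNat : ℕ) : ℤ) - ((m + (-u).toNat : ℕ) : ℤ)) = u := by omega
    have h2 : min (m + u.toNat) (m + (-u).toNat) = m := by omega
    simp only [h1, h2]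

lemma sum_card_reducedTriples (X : ℕ) :
    ∑ d ∈ Finset.Icc 1 X, (reducedTriples d).card
      = ∑ P ∈ Finset.Icc 1 (Nat.sqrt X), ((minValues X P 0).card
          + 2 * ∑ v ∈ Finset.Ico 1 (2 * P), (minValues X P v).card) := by
  rw [sum_card_reducedTriples_eq_sum_int]
  refine Finset.sum_congr rfl fun P hP => ?_
  have hP1 : 1 ≤ P := (Finset.mem_Icc.1 hP).1
  have := sum_Ioo_natAbs (fun v => (minValues X P v).card) (2 * P - 1)
  rw [show 2 * P - 1 + 1 = 2 * P by omega] at this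
  rw [← this]
  refine Finset.sum_congr ?_ fun _ _ => rfl
  congr 1 <;> omega

/-! ### Bounds for the slice with P fixed -/

lemma card_filter_not_two_dvd (G : ℕ) :
    ((Finset.Icc 1 G).filter fun m => ¬ 2 ∣ m).card = (G + 1) / 2 := by
  induction G with
  | zero => rfl
  | succ G ih =>
    rw [← Finset.insert_Icc_right_eq_Icc_add_one (by omega), Finset.filter_insert]
    split_ifs with h
    · rw [ih]; omega
    · rw [Finset.card_insert_of_notMem (by simp), ih]; omega

/-- The real number `g` with `g * (g + v) = x - P ^ 2`. -/
noncomputable def minBound (x : ℝ) (P v : ℕ) : ℝ :=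
  Real.sqrt (x - (P : ℝ) ^ 2 + (v : ℝ) ^ 2 / 4) - v / 2

lemma minBound_nonneg {x : ℝ} {P : ℕ} (v : ℕ) (hP : (P : ℝ) ^ 2 ≤ x) : 0 ≤ minBound x P v := by
  rw [minBound, sub_nonneg]
  apply Real.le_sqrt_of_sq_le
  linarith [show ((v : ℝ) / 2) ^ 2 = (v : ℝ) ^ 2 / 4 by ring]

lemma le_floor_iff_le_minBound {x : ℝ} {P : ℕ} (v m : ℕ) (hP : (P : ℝ) ^ 2 ≤ x) :
    P ^ 2 + m * (m + v) ≤ ⌊x⌋₊ ↔ m ≤ ⌊minBound x P v⌋₊ := by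
  have hY : 0 ≤ x - (P : ℝ) ^ 2 + (v : ℝ) ^ 2 / 4 := by nlinarith [sq_nonneg (v : ℝ)]
  rw [Nat.le_floor_iff ((sq_nonneg _).trans hP), Nat.le_floor_iff (minBound_nonneg v hP),
    minBound, le_sub_iff_add_le, Real.le_sqrt (by positivity) hY]
  push_cast
  constructor <;> intro h <;> nlinarith

lemma card_minValues {x : ℝ} {P : ℕ} (v : ℕ) (hP : (P : ℝ) ^ 2 ≤ x) :
    (minValues ⌊x⌋₊ P v).card
      = if 2 ∣ v then (⌊minBound x P v⌋₊ + 1) / 2 else ⌊minBound x P v⌋₊ := by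
  have hset : minValues ⌊x⌋₊ P v
      = (Finset.Icc 1 ⌊minBound x P v⌋₊).filter fun m => ¬(2 ∣ v ∧ 2 ∣ m) := by
    ext m
    rw [mem_minValues, Finset.mem_filter, Finset.mem_Icc, le_floor_iff_le_minBound v m hP,
      and_assoc]
  rw [hset]
  split_ifs with h
  · simp only [h, true_and]; exact card_filter_not_two_dvd _
  · simp [h]

lemma card_minValues_le {x g : ℝ} {P v : ℕ} (hP : (P : ℝ) ^ 2 ≤ x) (hg : minBound x P v ≤ g) :
    ((minValues ⌊x⌋₊ P v).card : ℝ) ≤ if 2 ∣ v then (g + 1) / 2 else g := by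
  have h0 := minBound_nonneg v hP
  have h1 : ((⌊minBound x P v⌋₊ : ℕ) : ℝ) ≤ g := (Nat.floor_le h0).trans hg
  rw [card_minValues v hP]
  split_ifs with h
  · refine (Nat.cast_div_le).trans ?_
    push_cast; linarith
  · exact h1

lemma le_card_minValues {x g : ℝ} {P v : ℕ} (hP : (P : ℝ) ^ 2 ≤ x) (hg : g ≤ minBound x P v) :
    (if 2 ∣ v then (g - 1) / 2 else g - 1) ≤ ((minValues ⌊x⌋₊ P v).card : ℝ) := by
  have h1 := Nat.lt_floor_add_one (minBound x P v)
  rw [card_minValues v hP]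
  split_ifs with h
  · have : ⌊minBound x P v⌋₊ ≤ 2 * ((⌊minBound x P v⌋₊ + 1) / 2) := by omega
    have : ((⌊minBound x P v⌋₊ : ℕ) : ℝ) ≤ 2 * (((⌊minBound x P v⌋₊ + 1) / 2 : ℕ) : ℝ) := by
      exact_mod_cast this
    linarith
  · linarith

lemma sum_range_two_mul_ite (k : ℕ) (a b e e' : ℝ) :
    ∑ v ∈ Finset.range (2 * k),
        (if 2 ∣ v then (a + b * (v : ℝ) + e) / 2 else a + b * (v : ℝ) + e')
      = k * (3 / 2 * a + b + e / 2 + e') + 3 / 2 * b * (k * (k - 1)) := by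
  induction k with
  | zero => simp
  | succ k ih =>
    rw [show 2 * (k + 1) = 2 * k + 1 + 1 by ring, Finset.sum_range_succ, Finset.sum_range_succ, ih,
      if_pos (by omega), if_neg (by omega)]
    push_cast; ring

/-- `minBound` is convex in v, with value r - P at v = 2P and c = √(r² - P²) at v = 0. The chord is
raised at v = 0 to a polynomial in P, so that the sum over P is explicit. -/
lemma minBound_le_chord {r : ℝ} {P v : ℕ} (hr : 0 < r) (hP0 : 0 < P) (hP : (P : ℝ) ≤ r)
    (hv : v ≤ 2 * P) :
    minBound (r ^ 2) P v ≤ (25 / 24 * r - 2 / 3 * (P : ℝ) ^ 2 / r)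
      + ((r - P) - (25 / 24 * r - 2 / 3 * (P : ℝ) ^ 2 / r)) / (2 * P) * v := by
  have hPr : (0 : ℝ) < P := by exact_mod_cast hP0
  have hvr : (v : ℝ) ≤ 2 * P := by exact_mod_cast hv
  set c := Real.sqrt (r ^ 2 - (P : ℝ) ^ 2) with hc
  have hY : 0 ≤ r ^ 2 - (P : ℝ) ^ 2 := by nlinarith
  have hc2 : c ^ 2 = r ^ 2 - (P : ℝ) ^ 2 := Real.sq_sqrt hY
  have hc0 : 0 ≤ c := Real.sqrt_nonneg _
  have hcr : c ≤ r := by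
    apply Real.sqrt_le_iff.2 ⟨hr.le, by nlinarith⟩
  have hcle : c ≤ 25 / 24 * r - 2 / 3 * (P : ℝ) ^ 2 / r := by
    rw [le_sub_iff_add_le, ← le_sub_iff_add_le', div_le_iff₀ hr]
    -- Linearizing c against c² = r² - P² at c = 3r/4 gives c ≤ 2c²/(3r) + 3r/8, the source of 25/24
    -- and 2/3.
    nlinarith [sq_nonneg (c - 3 / 4 * r)]
  set c₀ := 25 / 24 * r - 2 / 3 * (P : ℝ) ^ 2 / r
  set t : ℝ := v / (2 * P) with ht
  have ht0 : 0 ≤ t := by positivity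
  have ht1 : t ≤ 1 := by rw [ht, div_le_one (by positivity)]; exact hvr
  have hvt : (v : ℝ) = 2 * P * t := by rw [ht]; field_simp
  have hsq : Real.sqrt (r ^ 2 - (P : ℝ) ^ 2 + (v : ℝ) ^ 2 / 4) ≤ (1 - t) * c + t * r := by
    rw [Real.sqrt_le_iff]
    have h1t : 0 ≤ 1 - t := by linarith
    refine ⟨by positivity, ?_⟩
    have h1 : (v : ℝ) ^ 2 / 4 = P ^ 2 * t ^ 2 := by rw [hvt]; ring
    have h2 : (P : ℝ) ^ 2 = r ^ 2 - c ^ 2 := by linarith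
    rw [h1, h2]
    nlinarith [mul_nonneg (mul_nonneg ht0 h1t) (mul_nonneg hc0 (sub_nonneg.2 hcr))]
  have h3 : (r - P - c₀) / (2 * P) * (v : ℝ) = (r - P - c₀) * t := by rw [ht]; ring
  rw [minBound, h3]
  have h4 : (v : ℝ) / 2 = P * t := by rw [hvt]; ring
  rw [h4]
  nlinarith [mul_le_mul_of_nonneg_left hcle (sub_nonneg.2 ht1)]

/-- By convexity in v the graph lies above its tangent at v = 2P, where the square root equals r. -/
lemma tangent_le_minBound {r : ℝ} {P v : ℕ} (hr : 0 < r) (hP : (P : ℝ) ≤ r) (hv : v ≤ 2 * P) :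
    (r ^ 2 - (P : ℝ) ^ 2) / r + (P / r - 1) / 2 * v ≤ minBound (r ^ 2) P v := by
  have hvr : (v : ℝ) ≤ 2 * P := by exact_mod_cast hv
  have hv0 : (0 : ℝ) ≤ v := Nat.cast_nonneg v
  have hP0 : (0 : ℝ) ≤ P := Nat.cast_nonneg P
  have h1 : (r ^ 2 - (P : ℝ) ^ 2 + P * v / 2) / r
      ≤ Real.sqrt (r ^ 2 - (P : ℝ) ^ 2 + (v : ℝ) ^ 2 / 4) := by
    apply Real.le_sqrt_of_sq_le
    rw [div_pow, div_le_iff₀ (by positivity)]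
    have hD : 0 ≤ (P : ℝ) - v / 2 := by linarith
    have hrP : (P : ℝ) ^ 2 ≤ r ^ 2 := by nlinarith
    nlinarith [mul_nonneg (mul_nonneg hD hD) (sub_nonneg.2 hrP)]
  rw [minBound]
  have : (r ^ 2 - (P : ℝ) ^ 2) / r + (P / r - 1) / 2 * v
      = (r ^ 2 - (P : ℝ) ^ 2 + P * v / 2) / r - v / 2 := by field_simp; ring
  linarith

lemma slice_le {r : ℝ} {P : ℕ} (hr : 0 < r) (hP0 : 0 < P) (hP : (P : ℝ) ≤ r) :
    ((minValues ⌊r ^ 2⌋₊ P 0).card : ℝ)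
        + 2 * ∑ v ∈ Finset.Ico 1 (2 * P), ((minValues ⌊r ^ 2⌋₊ P v).card : ℝ)
      ≤ 49 / 16 * r * P - 3 / 2 * (P : ℝ) ^ 2 - (P : ℝ) ^ 3 / r + 3 / 2 * P - r / 2 - 1 / 2 := by
  have hPr : (0 : ℝ) < P := by exact_mod_cast hP0
  have hPx : (P : ℝ) ^ 2 ≤ r ^ 2 := by nlinarith
  set a := 25 / 24 * r - 2 / 3 * (P : ℝ) ^ 2 / r with ha
  set b := ((r - P) - a) / (2 * P) with hb
  have hbound : ∀ v : ℕ, v ≤ 2 * P →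
      ((minValues ⌊r ^ 2⌋₊ P v).card : ℝ) ≤ if 2 ∣ v then (a + b * v + 1) / 2 else a + b * v :=
    fun v hv =>
    card_minValues_le hPx (minBound_le_chord hr hP0 hP hv)
  have h0 := hbound 0 (by omega)
  have hsum : ∑ v ∈ Finset.Ico 1 (2 * P), ((minValues ⌊r ^ 2⌋₊ P v).card : ℝ)
      ≤ ∑ v ∈ Finset.Ico 1 (2 * P), if 2 ∣ v then (a + b * v + 1) / 2 else a + b * v :=
    Finset.sum_le_sum fun v hv => hbound v (Finset.mem_Ico.1 hv).2.le
  have htot := sum_range_two_mul_ite P a b 1 0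
  -- The term v = 0 is split off because it counts once, every other v twice.
  rw [Finset.range_eq_Ico, Finset.sum_eq_sum_Ico_succ_bot (by omega)] at htot
  norm_num at htot hsum h0
  have hbP : b * P = ((r - P) - a) / 2 := by rw [hb]; field_simp
  have haP : a * P = 25 / 24 * r * P - 2 / 3 * (P : ℝ) ^ 3 / r := by rw [ha]; ring
  have hbP2 : b * (P * (P - 1)) = ((r - P) - a) / 2 * (P - 1) := by rw [← hbP]; ring
  have hcube : 2 / 3 * (P : ℝ) ^ 3 / r = 2 / 3 * ((P : ℝ) ^ 3 / r) := by ring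
  nlinarith

lemma le_slice {r : ℝ} {P : ℕ} (hr : 0 < r) (hP0 : 0 < P) (hP : (P : ℝ) ≤ r) :
    3 * r * P - 3 / 2 * (P : ℝ) ^ 2 - 3 / 2 * ((P : ℝ) ^ 3 / r) - 3 * P - r / 2
      ≤ ((minValues ⌊r ^ 2⌋₊ P 0).card : ℝ)
        + 2 * ∑ v ∈ Finset.Ico 1 (2 * P), ((minValues ⌊r ^ 2⌋₊ P v).card : ℝ) := by
  have hPr : (0 : ℝ) < P := by exact_mod_cast hP0
  have hPx : (P : ℝ) ^ 2 ≤ r ^ 2 := by nlinarith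
  set a := (r ^ 2 - (P : ℝ) ^ 2) / r with ha
  set b := ((P : ℝ) / r - 1) / 2 with hb
  have hbound : ∀ v : ℕ, v ≤ 2 * P →
      (if 2 ∣ v then ((a + b * v) - 1) / 2 else (a + b * v) - 1)
        ≤ ((minValues ⌊r ^ 2⌋₊ P v).card : ℝ) := fun v hv =>
    le_card_minValues hPx (tangent_le_minBound hr hP hv)
  have hsum := Finset.sum_le_sum fun v (hv : v ∈ Finset.Ico 1 (2 * P)) =>
    hbound v (Finset.mem_Ico.1 hv).2.le
  have h0 := hbound 0 (by omega)
  have htot := sum_range_two_mul_ite P a b (-1) (-1)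
  rw [Finset.range_eq_Ico, Finset.sum_eq_sum_Ico_succ_bot (by omega)] at htot
  norm_num at htot hsum h0
  simp only [← sub_eq_add_neg] at htot
  have haP : a = r - (P : ℝ) ^ 2 / r := by rw [ha]; field_simp
  have haP' : a * P = r * P - (P : ℝ) ^ 3 / r := by rw [haP]; ring
  have hbP : b * P = ((P : ℝ) ^ 2 / r - P) / 2 := by rw [hb]; ring
  have hbP2 : b * (P * (P - 1)) = ((P : ℝ) ^ 3 / r - P ^ 2) / 2 - b * P := by rw [hb]; ring
  have hneg : 0 ≤ (P : ℝ) ^ 2 / r := by positivity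
  have hneg' : (P : ℝ) ^ 2 / r ≤ P := by
    rw [div_le_iff₀ hr]; nlinarith
  nlinarith

/-! ### Summation over P -/

lemma sum_Icc_one_cast (n : ℕ) : ∑ P ∈ Finset.Icc 1 n, (P : ℝ) = n * (n + 1) / 2 := by
  induction n with
  | zero => simp
  | succ n ih => rw [Finset.sum_Icc_succ_top (by omega), ih]; push_cast; ring

lemma sum_Icc_one_cast_sq (n : ℕ) :
    ∑ P ∈ Finset.Icc 1 n, (P : ℝ) ^ 2 = n * (n + 1) * (2 * n + 1) / 6 := by
  induction n with
  | zero => simp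
  | succ n ih => rw [Finset.sum_Icc_succ_top (by omega), ih]; push_cast; ring

lemma sum_Icc_one_cast_cube (n : ℕ) :
    ∑ P ∈ Finset.Icc 1 n, (P : ℝ) ^ 3 = (n : ℝ) ^ 2 * (n + 1) ^ 2 / 4 := by
  induction n with
  | zero => simp
  | succ n ih => rw [Finset.sum_Icc_succ_top (by omega), ih]; push_cast; ring

lemma natSqrt_floor_sq {r : ℝ} (hr : 0 ≤ r) : Nat.sqrt ⌊r ^ 2⌋₊ = ⌊r⌋₊ := by
  symm
  rw [Nat.eq_sqrt']
  constructor
  · apply Nat.le_floor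
    push_cast
    exact pow_le_pow_left₀ (Nat.cast_nonneg _) (Nat.floor_le hr) 2
  · rw [Nat.floor_lt (by positivity)]
    push_cast
    exact pow_lt_pow_left₀ (Nat.lt_floor_add_one r) hr two_ne_zero

lemma sum_card_reducedTriples_cast {r : ℝ} (hr : 0 < r) :
    ∑ d ∈ Finset.Icc 1 ⌊r ^ 2⌋₊, ((reducedTriples d).card : ℝ)
      = ∑ P ∈ Finset.Icc 1 ⌊r⌋₊, (((minValues ⌊r ^ 2⌋₊ P 0).card : ℝ)
          + 2 * ∑ v ∈ Finset.Ico 1 (2 * P), ((minValues ⌊r ^ 2⌋₊ P v).card : ℝ)) := by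
  have := sum_card_reducedTriples ⌊r ^ 2⌋₊
  rw [natSqrt_floor_sq hr.le] at this
  exact_mod_cast this

lemma sum_card_reducedTriples_le {r : ℝ} (hr : 0 < r) :
    ∑ d ∈ Finset.Icc 1 ⌊r ^ 2⌋₊, ((reducedTriples d).card : ℝ)
      ≤ 49 / 32 * r * (⌊r⌋₊ * (⌊r⌋₊ + 1)) - ⌊r⌋₊ * (⌊r⌋₊ + 1) * (2 * ⌊r⌋₊ + 1) / 4
        - (⌊r⌋₊ : ℝ) ^ 2 * (⌊r⌋₊ + 1) ^ 2 / (4 * r) + 3 / 4 * (⌊r⌋₊ * (⌊r⌋₊ + 1))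
        - ⌊r⌋₊ * r / 2 - ⌊r⌋₊ / 2 := by
  rw [sum_card_reducedTriples_cast hr]
  refine (Finset.sum_le_sum fun P hP => slice_le hr (Finset.mem_Icc.1 hP).1
    ((Nat.le_floor_iff hr.le).1 (Finset.mem_Icc.1 hP).2)).trans (le_of_eq ?_)
  simp only [Finset.sum_sub_distrib, Finset.sum_add_distrib, ← Finset.mul_sum, ← Finset.sum_div,
    sum_Icc_one_cast, sum_Icc_one_cast_sq, sum_Icc_one_cast_cube, Finset.sum_const, Nat.card_Icc,
    nsmul_eq_mul]
  push_cast
  field_simp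
  ring

/-- The leading terms of `le_slice` sum to 3/2 - 1/2 - 3/8 = 5/8. A lower bound is needed because
the dyadic sum is a difference of two counts. -/
lemma le_sum_card_reducedTriples {r : ℝ} (hr : 1 ≤ r) :
    5 / 8 * r ^ 3 - 10 * r ^ 2
      ≤ ∑ d ∈ Finset.Icc 1 ⌊r ^ 2⌋₊, ((reducedTriples d).card : ℝ) := by
  have hr0 : 0 < r := by linarith
  rw [sum_card_reducedTriples_cast hr0]
  refine le_trans ?_ (Finset.sum_le_sum fun P hP => le_slice hr0 (Finset.mem_Icc.1 hP).1
    ((Nat.le_floor_iff hr0.le).1 (Finset.mem_Icc.1 hP).2))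
  simp only [Finset.sum_sub_distrib, ← Finset.mul_sum, ← Finset.sum_div,
    sum_Icc_one_cast, sum_Icc_one_cast_sq, sum_Icc_one_cast_cube, Finset.sum_const, Nat.card_Icc,
    nsmul_eq_mul]
  push_cast
  have hn0 : (0 : ℝ) ≤ ⌊r⌋₊ := Nat.cast_nonneg _
  have hn1 : (⌊r⌋₊ : ℝ) ≤ r := Nat.floor_le hr0.le
  have hn2 : r < ⌊r⌋₊ + 1 := Nat.lt_floor_add_one r
  set n : ℝ := ((⌊r⌋₊ : ℕ) : ℝ)
  have e1 : (r - 1) * r ≤ n * (n + 1) := by nlinarith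
  have e1' : n * (n + 1) ≤ r * (r + 1) := by nlinarith
  have e2 : n * (n + 1) * (2 * n + 1) ≤ r * (r + 1) * (2 * r + 1) := by gcongr
  have e3 : n ^ 2 * (n + 1) ^ 2 / 4 / r ≤ r * (r + 1) ^ 2 / 4 := by
    rw [div_le_iff₀ hr0]
    have : n ^ 2 * (n + 1) ^ 2 ≤ r ^ 2 * (r + 1) ^ 2 := by gcongr
    linarith
  have e4 : 3 * r * ((r - 1) * r / 2) ≤ 3 * r * (n * (n + 1) / 2) := by gcongr
  have e6 : n * r ≤ r * r := by gcongr
  nlinarith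

/-- The leading terms of `slice_le` sum to 49/32 - 1/2 - 1/4 = 25/32. -/
lemma sum_card_reducedTriples_le_asymptotic {r : ℝ} (hr : 1 ≤ r) :
    ∑ d ∈ Finset.Icc 1 ⌊r ^ 2⌋₊, ((reducedTriples d).card : ℝ) ≤ 25 / 32 * r ^ 3 + 8 * r ^ 2 := by
  have hr0 : 0 < r := by linarith
  refine (sum_card_reducedTriples_le hr0).trans ?_
  have hn0 : (0 : ℝ) ≤ ⌊r⌋₊ := Nat.cast_nonneg _
  have hn1 : (⌊r⌋₊ : ℝ) ≤ r := Nat.floor_le hr0.le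
  have hn2 : r < ⌊r⌋₊ + 1 := Nat.lt_floor_add_one r
  set n : ℝ := ((⌊r⌋₊ : ℕ) : ℝ)
  have e1 : n * (n + 1) ≤ r * (r + 1) := by gcongr
  have e0 : (r - 1) * r ≤ n * (n + 1) := by nlinarith
  have e2 : (r - 1) * r * (2 * r - 1) ≤ n * (n + 1) * (2 * n + 1) := by
    have : 0 ≤ (r - 1) * r := mul_nonneg (by linarith) hr0.le
    apply mul_le_mul e0 <;> nlinarith
  have e3 : r * (r - 1) ^ 2 / 4 ≤ n ^ 2 * (n + 1) ^ 2 / (4 * r) := by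
    rw [le_div_iff₀ (by positivity)]
    have : ((r - 1) * r) ^ 2 ≤ (n * (n + 1)) ^ 2 :=
      pow_le_pow_left₀ (mul_nonneg (by linarith) hr0.le) e0 2
    nlinarith
  have e4 : 49 / 32 * r * (n * (n + 1)) ≤ 49 / 32 * r * (r * (r + 1)) := by gcongr
  have e5 : 0 ≤ n * r := by positivity
  nlinarith

/-- The constant 0.924 lies just below 4/3·log 2. The polynomial bound is still too weak at r = 3.
-/
lemma sum_card_reducedTriples_le_of_four_le {r : ℝ} (hr : 4 ≤ r) :
    ∑ d ∈ Finset.Icc 1 ⌊r ^ 2⌋₊, ((reducedTriples d).card : ℝ) ≤ 924 / 1000 * r ^ 3 := by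
  have hr0 : 0 < r := by linarith
  refine (sum_card_reducedTriples_le hr0).trans ?_
  have hn1 : (⌊r⌋₊ : ℝ) ≤ r := Nat.floor_le hr0.le
  have hn4 : (4 : ℝ) ≤ ⌊r⌋₊ := by exact_mod_cast Nat.le_floor (by exact_mod_cast hr)
  have hn2 : r < ⌊r⌋₊ + 1 := Nat.lt_floor_add_one r
  generalize (⌊r⌋₊ : ℝ) = n at *
  obtain ⟨k, rfl⟩ : ∃ k, n = 4 + k := ⟨n - 4, by ring⟩
  obtain ⟨δ, rfl⟩ : ∃ δ, r = 4 + k + δ := ⟨r - (4 + k), by ring⟩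
  have hk : 0 ≤ k := by linarith
  have hδ : 0 ≤ δ := by linarith
  have hδ1 : 0 ≤ 1 - δ := by linarith
  rw [← sub_nonneg]
  have key : 924 / 1000 * (4 + k + δ) ^ 3
      - (49 / 32 * (4 + k + δ) * ((4 + k) * (4 + k + 1))
        - (4 + k) * (4 + k + 1) * (2 * (4 + k) + 1) / 4
        - (4 + k) ^ 2 * (4 + k + 1) ^ 2 / (4 * (4 + k + δ)) + 3 / 4 * ((4 + k) * (4 + k + 1))
        - (4 + k) * (4 + k + δ) / 2 - (4 + k) / 2)
      = (924 / 1000 * (4 + k + δ) ^ 4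
      - (49 / 32 * (4 + k + δ) ^ 2 * ((4 + k) * (4 + k + 1))
        - (4 + k) * (4 + k + 1) * (2 * (4 + k) + 1) / 4 * (4 + k + δ)
        - (4 + k) ^ 2 * (4 + k + 1) ^ 2 / 4
        + 3 / 4 * ((4 + k) * (4 + k + 1)) * (4 + k + δ)
        - (4 + k) * (4 + k + δ) ^ 2 / 2 - (4 + k) / 2 * (4 + k + δ))) / (4 + k + δ) := by
    field_simp
  rw [key]
  apply div_nonneg _ hr0.le
  ring_nf
  -- In the shifted variables k, δ ≥ 0 every coefficient of the numerator is nonnegative.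
  positivity

/-- The finite range r < 4 by evaluation, squared to stay in ℕ; 0.853 < 0.924². -/
lemma sum_card_reducedTriples_sq_le {k : ℕ} (hk : k ≤ 15) :
    1000 * (∑ d ∈ Finset.Icc 1 k, (reducedTriples d).card) ^ 2 ≤ 853 * k ^ 3 := by
  revert k
  decide +kernel

/-! ### Residue classes and pairs of modular square roots -/

lemma card_mul_le_of_modEq {S : Finset ℕ} {m l L : ℕ} (hS : ∀ s ∈ S, m ≤ s ∧ s < m + l)
    (hc : ∀ s ∈ S, ∀ t ∈ S, s ≡ t [MOD L]) : S.card * L ≤ l + L - 1 := by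
  rcases Nat.eq_zero_or_pos L with rfl | hL
  · simp
  rw [← Nat.le_div_iff_mul_le hL, ← Finset.card_range ((l + L - 1) / L)]
  refine Finset.card_le_card_of_injOn (fun s => (s - m) / L) ?_ ?_
  · intro s hs
    have := hS s hs
    simp only [Finset.coe_range, Set.mem_Iio]
    rw [← Nat.succ_le_iff, Nat.succ_eq_add_one, ← Nat.add_div_right _ hL]
    exact Nat.div_le_div_right (by omega)
  · intro s hs t ht hst
    have h1 := hS s hs
    have h2 := hS t ht
    have h3 : s - m ≡ t - m [MOD L] := by
      apply Nat.ModEq.add_right_cancel' m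
      rw [Nat.sub_add_cancel h1.1, Nat.sub_add_cancel h2.1]
      exact hc s hs t ht
    have h4 := Nat.div_add_mod (s - m) L
    have h5 := Nat.div_add_mod (t - m) L
    simp only at hst
    rw [hst, h3, h5] at h4
    omega

lemma card_mul_le_of_modEq_of_dvd {S : Finset ℕ} {A L : ℕ} (hA : L ∣ A) (hA0 : 0 < A)
    (hS : ∀ s ∈ S, s < A) (hc : ∀ s ∈ S, ∀ t ∈ S, s ≡ t [MOD L]) : S.card * L ≤ A := by
  have h := card_mul_le_of_modEq (m := 0) (fun s hs => ⟨Nat.zero_le _, by simpa using hS s hs⟩) hc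
  obtain ⟨k, rfl⟩ := hA
  have hL : 0 < L := Nat.pos_of_mul_pos_right hA0
  have : S.card * L < (k + 1) * L := by
    have : (k + 1) * L = L * k + L := by ring
    omega
  have := Nat.lt_of_mul_lt_mul_right this
  rw [mul_comm L k]
  exact Nat.mul_le_mul_right L (by omega)

/-- Given b, a is fixed modulo lcm(e, f). Such an a exists only if c = gcd(e, f) divides 2b, i.e.
c/gcd(c, 2) divides b; this costs the factor gcd(e, 2). -/
lemma card_filter_modEq_dvd_add_mul_le {e f A B : ℕ} (hA : e * f ∣ A) (hB : e * f ∣ B)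
    (hA0 : 0 < A) (hB0 : 0 < B) :
    ((Finset.range A ×ˢ Finset.range B).filter
      fun p => p.1 ≡ p.2 [MOD e] ∧ f ∣ p.1 + p.2).card * (e * f) ≤ A * B * Nat.gcd e 2 := by
  have he : 0 < e := Nat.pos_of_dvd_of_pos ((dvd_mul_right e f).trans hA) hA0
  set c := Nat.gcd e f with hc
  have hc0 : 0 < c := Nat.gcd_pos_of_pos_left _ he
  set good := (Finset.range B).filter fun b => c ∣ 2 * b with hgood
  have hL : Nat.lcm e f ∣ A := (Nat.lcm_dvd (dvd_mul_right e f) (dvd_mul_left f e)).trans hA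
  have hfib : ∀ b, ((Finset.range A).filter fun a => a ≡ b [MOD e] ∧ f ∣ a + b).card * Nat.lcm e f
      ≤ A := by
    intro b
    refine card_mul_le_of_modEq_of_dvd hL hA0 (fun s hs => ?_) fun s hs t ht => ?_
    · exact Finset.mem_range.1 (Finset.mem_filter.1 hs).1
    · have h1 := (Finset.mem_filter.1 hs).2
      have h2 := (Finset.mem_filter.1 ht).2
      refine Nat.mod_lcm (h1.1.trans h2.1.symm) ?_
      apply Nat.ModEq.add_right_cancel' b
      exact ((Nat.modEq_zero_iff_dvd).2 h1.2).trans ((Nat.modEq_zero_iff_dvd).2 h2.2).symm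
  have hcard : ((Finset.range A ×ˢ Finset.range B).filter
      fun p => p.1 ≡ p.2 [MOD e] ∧ f ∣ p.1 + p.2).card * Nat.lcm e f ≤ good.card * A := by
    have hmaps : ∀ p ∈ (Finset.range A ×ˢ Finset.range B).filter
        (fun p => p.1 ≡ p.2 [MOD e] ∧ f ∣ p.1 + p.2), p.2 ∈ good := by
      intro p hp
      simp only [Finset.mem_filter, Finset.mem_product, Finset.mem_range] at hp
      simp only [hgood, Finset.mem_filter, Finset.mem_range]
      refine ⟨hp.1.2, ?_⟩
      have h1 : p.1 ≡ p.2 [MOD c] := hp.2.1.of_dvd (Nat.gcd_dvd_left e f)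
      have h2 : c ∣ p.1 + p.2 := (Nat.gcd_dvd_right e f).trans hp.2.2
      rw [two_mul]
      exact (Nat.modEq_zero_iff_dvd).1
        ((h1.add_right p.2).symm.trans ((Nat.modEq_zero_iff_dvd).2 h2))
    rw [Finset.card_eq_sum_card_fiberwise hmaps, Finset.sum_mul]
    refine (Finset.sum_le_card_nsmul _ _ A fun b _ => ?_)
    refine le_trans (Nat.mul_le_mul_right _ ?_) (hfib b)
    refine Finset.card_le_card_of_injOn Prod.fst ?_ ?_
    · intro p hp
      simp only [Finset.coe_filter, Finset.mem_filter, Finset.mem_product, Finset.mem_range,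
        Set.mem_ofPred_eq] at hp ⊢
      rw [← hp.2]
      exact ⟨hp.1.1.1, hp.1.2⟩
    · intro p hp q hq hpq
      simp only [Finset.coe_filter, Finset.mem_filter, Set.mem_ofPred_eq] at hp hq
      exact Prod.ext hpq (hp.2.trans hq.2.symm)
  obtain ⟨c', t, hcop, hc', ht⟩ := Nat.exists_coprime c 2
  set w := Nat.gcd c 2 with hw
  have hw0 : 0 < w := Nat.gcd_pos_of_pos_right _ two_pos
  have hgc : good.card * c' ≤ B := by
    have hdiv : ∀ b ∈ good, c' ∣ b := by
      intro b hb
      have h1 : c ∣ 2 * b := (Finset.mem_filter.1 hb).2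
      rw [hc', ht, show t * w * b = t * b * w by ring] at h1
      exact hcop.dvd_of_dvd_mul_left (Nat.dvd_of_mul_dvd_mul_right hw0 h1)
    refine card_mul_le_of_modEq_of_dvd ?_ hB0 (fun s hs => ?_) fun s hs t ht => ?_
    · have h1 : c' ∣ c := ⟨w, hc'⟩
      exact (h1.trans (Nat.gcd_dvd_left e f)).trans ((dvd_mul_right e f).trans hB)
    · exact Finset.mem_range.1 (Finset.mem_filter.1 hs).1
    · exact ((Nat.modEq_zero_iff_dvd).2 (hdiv s hs)).trans
        ((Nat.modEq_zero_iff_dvd).2 (hdiv t ht)).symm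
  have hwle : w ≤ Nat.gcd e 2 :=
    Nat.le_of_dvd (Nat.gcd_pos_of_pos_right _ two_pos)
      (Nat.gcd_dvd_gcd_of_dvd_left 2 (Nat.gcd_dvd_left e f))
  set N := ((Finset.range A ×ˢ Finset.range B).filter
      fun p => p.1 ≡ p.2 [MOD e] ∧ f ∣ p.1 + p.2).card
  calc N * (e * f) = N * Nat.lcm e f * c := by rw [← Nat.gcd_mul_lcm e f]; ring
    _ ≤ good.card * A * c := Nat.mul_le_mul_right c hcard
    _ = A * (good.card * c') * w := by conv_lhs => rw [hc']
                                       ring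
    _ ≤ A * B * Nat.gcd e 2 := by gcongr

/-- Since g divides (b - a)(a + b), the choice e = gcd(g, |b - a|) leaves g/e coprime to the
remaining factor of b - a. -/
lemma dvd_add_of_sq_modEq {a b g : ℕ} (h : a ^ 2 ≡ b ^ 2 [MOD g]) (hg : 0 < g) :
    ∃ e ∈ g.divisors, a ≡ b [MOD e] ∧ g / e ∣ a + b := by
  set k := ((b : ℤ) - a).natAbs with hk
  have h1 : g ∣ k * (a + b) := by
    have h2 : (g : ℤ) ∣ ((b : ℤ) - a) * (a + b) := by
      have := (Nat.modEq_iff_dvd).1 h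
      push_cast at this
      rwa [show ((b : ℤ) - a) * (a + b) = b ^ 2 - a ^ 2 by ring]
    have h3 := Int.natAbs_dvd_natAbs.2 h2
    rw [Int.natAbs_mul] at h3
    rwa [Int.natAbs_natCast, ← hk, ← Nat.cast_add, Int.natAbs_natCast] at h3
  have hgcd0 : 0 < Nat.gcd g k := Nat.gcd_pos_of_pos_left _ hg
  refine ⟨Nat.gcd g k, Nat.mem_divisors.2 ⟨Nat.gcd_dvd_left _ _, hg.ne'⟩, ?_, ?_⟩
  · rw [Nat.modEq_iff_dvd, ← Int.dvd_natAbs, Int.natCast_dvd_natCast]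
    exact Nat.gcd_dvd_right _ _
  · obtain ⟨g', k', hcop, hg', hk'⟩ := Nat.exists_coprime g k
    have h4 : g / Nat.gcd g k = g' := Nat.div_eq_of_eq_mul_left hgcd0 hg'
    rw [h4]
    have h5 : g' * Nat.gcd g k ∣ k' * (a + b) * Nat.gcd g k := by
      rw [← hg', show k' * (a + b) * Nat.gcd g k = k' * Nat.gcd g k * (a + b) by ring, ← hk']
      exact h1
    exact hcop.dvd_of_dvd_mul_left (Nat.dvd_of_mul_dvd_mul_right hgcd0 h5)

lemma card_filter_sq_modEq_mul_le {A B : ℕ} (hA0 : 0 < A) (hB0 : 0 < B) :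
    ((Finset.range A ×ˢ Finset.range B).filter
      fun p => p.1 ^ 2 ≡ p.2 ^ 2 [MOD Nat.gcd A B]).card * Nat.gcd A B
      ≤ A * B * ∑ e ∈ (Nat.gcd A B).divisors, Nat.gcd e 2 := by
  set g := Nat.gcd A B with hg
  have hg0 : 0 < g := Nat.gcd_pos_of_pos_left _ hA0
  have hsub : ((Finset.range A ×ˢ Finset.range B).filter fun p => p.1 ^ 2 ≡ p.2 ^ 2 [MOD g])
      ⊆ g.divisors.biUnion fun e => (Finset.range A ×ˢ Finset.range B).filter
        fun p => p.1 ≡ p.2 [MOD e] ∧ g / e ∣ p.1 + p.2 := by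
    intro p hp
    obtain ⟨hp1, hp2⟩ := Finset.mem_filter.1 hp
    obtain ⟨e, he, h⟩ := dvd_add_of_sq_modEq hp2 hg0
    exact Finset.mem_biUnion.2 ⟨e, he, Finset.mem_filter.2 ⟨hp1, h⟩⟩
  refine (Nat.mul_le_mul_right g ((Finset.card_le_card hsub).trans Finset.card_biUnion_le)).trans ?_
  rw [Finset.sum_mul, Finset.mul_sum]
  refine Finset.sum_le_sum fun e he => ?_
  have heg : e * (g / e) = g := Nat.mul_div_cancel' (Nat.dvd_of_mem_divisors he)
  have := card_filter_modEq_dvd_add_mul_le (e := e) (f := g / e) (A := A) (B := B)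
    (by rw [heg]; exact Nat.gcd_dvd_left A B) (by rw [heg]; exact Nat.gcd_dvd_right A B) hA0 hB0
  rwa [heg] at this

/-- The square roots of `d` modulo `Q` in `[0, Q)`, restricted to `Q ^ 2 < d`. -/
def modRoots (Q d : ℕ) : Finset ℕ :=
  (Finset.range Q).filter fun a => Q ^ 2 < d ∧ d ≡ a ^ 2 [MOD Q]

lemma sum_card_modRoots_mul_le {A B : ℕ} (X : ℕ) (hA0 : 0 < A) (hB0 : 0 < B) :
    ∑ d ∈ Finset.Icc 1 X, (modRoots A d).card * (modRoots B d).card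
      ≤ X * ∑ e ∈ (Nat.gcd A B).divisors, Nat.gcd e 2 := by
  set rel : ℕ → ℕ × ℕ → Prop := fun d p =>
    (A ^ 2 < d ∧ d ≡ p.1 ^ 2 [MOD A]) ∧ (B ^ 2 < d ∧ d ≡ p.2 ^ 2 [MOD B]) with hrel
  have hdec : ∀ d p, Decidable (rel d p) := fun d p => by rw [hrel]; infer_instance
  have hprod : ∀ d, (modRoots A d).card * (modRoots B d).card
      = (Finset.bipartiteAbove rel (Finset.range A ×ˢ Finset.range B) d).card := by
    intro d
    rw [← Finset.card_product]
    congr 1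
    ext p
    simp only [modRoots, Finset.bipartiteAbove, Finset.mem_product, Finset.mem_filter, hrel]
    tauto
  simp_rw [hprod]
  rw [Finset.sum_card_bipartiteAbove_eq_sum_card_bipartiteBelow]
  set good := (Finset.range A ×ˢ Finset.range B).filter
      fun p => p.1 ^ 2 ≡ p.2 ^ 2 [MOD Nat.gcd A B] with hgood
  have hL : Nat.lcm A B ≤ max A B ^ 2 := by
    refine (Nat.le_of_dvd (Nat.mul_pos hA0 hB0)
      (Nat.lcm_dvd (dvd_mul_right A B) (dvd_mul_left B A))).trans ?_
    rw [sq]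
    exact Nat.mul_le_mul (le_max_left _ _) (le_max_right _ _)
  have hLpos : 0 < Nat.lcm A B := Nat.lcm_pos hA0 hB0
  have hfib : ∀ p ∈ Finset.range A ×ˢ Finset.range B,
      (Finset.bipartiteBelow rel (Finset.Icc 1 X) p).card * Nat.lcm A B
        ≤ if p.1 ^ 2 ≡ p.2 ^ 2 [MOD Nat.gcd A B] then X else 0 := by
    intro p _
    rcases (Finset.bipartiteBelow rel (Finset.Icc 1 X) p).eq_empty_or_nonempty with h0 | ⟨d, hd⟩
    · rw [h0]; simp
    have hmem : ∀ s ∈ Finset.bipartiteBelow rel (Finset.Icc 1 X) p,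
        s ≤ X ∧ max A B ^ 2 < s ∧ s ≡ p.1 ^ 2 [MOD A] ∧ s ≡ p.2 ^ 2 [MOD B] := by
      intro s hs
      simp only [Finset.bipartiteBelow, Finset.mem_filter, Finset.mem_Icc, hrel] at hs
      refine ⟨hs.1.2, ?_, hs.2.1.2, hs.2.2.2⟩
      rcases max_choice A B with h | h <;> rw [h]
      · exact hs.2.1.1
      · exact hs.2.2.1
    obtain ⟨hdX, hdM, hdA, hdB⟩ := hmem d hd
    rw [if_pos ((hdA.of_dvd (Nat.gcd_dvd_left A B)).symm.trans
      (hdB.of_dvd (Nat.gcd_dvd_right A B)))]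
    -- Only d > max(A, B)² occur, and lcm(A, B) ≤ max(A, B)². The omitted initial segment therefore
    -- absorbs the rounding loss, leaving X/lcm with no error term.
    have := card_mul_le_of_modEq (S := Finset.bipartiteBelow rel (Finset.Icc 1 X) p)
      (m := max A B ^ 2 + 1) (l := X - max A B ^ 2) (L := Nat.lcm A B)
      (fun s hs => by have := hmem s hs; omega)
      (fun s hs t ht => by
        obtain ⟨-, -, h1, h2⟩ := hmem s hs
        obtain ⟨-, -, h3, h4⟩ := hmem t ht
        exact Nat.mod_lcm (h1.trans h3.symm) (h2.trans h4.symm))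
    omega
  have hsum : (∑ p ∈ Finset.range A ×ˢ Finset.range B,
      (Finset.bipartiteBelow rel (Finset.Icc 1 X) p).card) * Nat.lcm A B ≤ X * good.card := by
    rw [Finset.sum_mul]
    refine (Finset.sum_le_sum hfib).trans (le_of_eq ?_)
    rw [← Finset.sum_filter, Finset.sum_const, smul_eq_mul, mul_comm]
  have hg := card_filter_sq_modEq_mul_le hA0 hB0
  refine Nat.le_of_mul_le_mul_right ?_ (Nat.mul_pos hA0 hB0)
  rw [← Nat.gcd_mul_lcm A B]
  calc _ = (∑ p ∈ Finset.range A ×ˢ Finset.range B,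
      (Finset.bipartiteBelow rel (Finset.Icc 1 X) p).card) * Nat.lcm A B * Nat.gcd A B := by ring
    _ ≤ X * good.card * Nat.gcd A B := Nat.mul_le_mul_right _ hsum
    _ = X * (good.card * Nat.gcd A B) := by ring
    _ ≤ X * (A * B * ∑ e ∈ (Nat.gcd A B).divisors, Nat.gcd e 2) := Nat.mul_le_mul_left _ hg
    _ = _ := by rw [Nat.gcd_mul_lcm]; ring

/-! ### The second moment -/

/-- Swapping Q and R costs a factor 2 and allows Q ≤ R, hence Q² < d. Then (Q, P mod Q) determines
the triple. -/
lemma card_reducedTriples_le {X d : ℕ} (hd : d ≤ X) :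
    (reducedTriples d).card ≤ 2 * ∑ Q ∈ Finset.Icc 1 (Nat.sqrt X), (modRoots Q d).card := by
  have hle : ((reducedTriples d).filter fun t => t.2.1 ≤ t.2.2).card
      ≤ ∑ Q ∈ Finset.Icc 1 (Nat.sqrt X), (modRoots Q d).card := by
    rw [← Finset.card_sigma]
    refine Finset.card_le_card_of_injOn (fun t => ⟨t.2.1, t.1 % t.2.1⟩) ?_ ?_
    · rintro ⟨P, Q, R⟩ ht
      simp only [Finset.coe_filter, Set.mem_ofPred_eq, mem_reducedTriples] at ht
      obtain ⟨⟨hQ, hR, h, h1, h2, h3⟩, hQR⟩ := ht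
      have hP : 0 < P := by omega
      have hQd : Q ^ 2 < d := by nlinarith [Nat.mul_le_mul_left Q hQR, pow_pos hP 2]
      simp only [Finset.coe_sigma, Set.mem_sigma_iff, Finset.coe_Icc, Set.mem_Icc, modRoots,
        Finset.coe_filter, Finset.mem_range, Set.mem_ofPred_eq]
      refine ⟨⟨hQ, ?_⟩, Nat.mod_lt _ hQ, hQd, ?_⟩
      · rw [Nat.le_sqrt']; omega
      · rw [← h]
        have : P ^ 2 + Q * R ≡ P ^ 2 [MOD Q] := by simp [Nat.ModEq]
        exact this.trans ((Nat.mod_modEq P Q).symm.pow 2)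
    · have key : ∀ {P P' Q R R' : ℕ}, IsReducedTriple d P Q R → IsReducedTriple d P' Q R' →
          P % Q = P' % Q → P' ≤ P := by
        rintro P P' Q R R' ⟨hQ, hR, h, h1, h2, h3⟩ ⟨-, hR', h', -⟩ hmod
        by_contra! hlt
        have hge : P + Q ≤ P' := by
          have h4 := Nat.ModEq.add_le_of_lt (m := Q) hmod hlt
          exact h4
        -- P' ≥ P + Q would give P'² ≥ P² + Q(Q + 2P) > P² + QR = d.
        nlinarith [Nat.mul_le_mul hge hge, Nat.mul_lt_mul_of_pos_left h2 hQ, Nat.mul_pos hQ hR']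
      rintro ⟨P, Q, R⟩ ht ⟨P', Q', R'⟩ ht' heq
      simp only [Finset.coe_filter, Set.mem_ofPred_eq, mem_reducedTriples] at ht ht'
      simp only [Sigma.mk.injEq] at heq
      obtain ⟨rfl, hmod⟩ := heq
      have hmod' := eq_of_heq hmod
      obtain rfl : P = P' := le_antisymm (key ht'.1 ht.1 hmod'.symm) (key ht.1 ht'.1 hmod')
      have h1 := ht.1.2.2.1
      have h2 := ht'.1.2.2.1
      have : R = R' := Nat.eq_of_mul_eq_mul_left ht.1.1 (by omega)
      rw [this]
  have hswap : ((reducedTriples d).filter fun t => ¬ t.2.1 ≤ t.2.2).card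
      ≤ ((reducedTriples d).filter fun t => t.2.1 ≤ t.2.2).card := by
    refine Finset.card_le_card_of_injOn (fun t => (t.1, t.2.2, t.2.1)) ?_ ?_
    · rintro ⟨P, Q, R⟩ ht
      simp only [Finset.coe_filter, Set.mem_ofPred_eq, mem_reducedTriples] at ht ⊢
      obtain ⟨⟨hQ, hR, h, h1, h2, h3⟩, hQR⟩ := ht
      exact ⟨⟨hR, hQ, by rw [mul_comm]; exact h, h2, h1, fun h => h3 h.symm⟩, by omega⟩
    · rintro ⟨P, Q, R⟩ - ⟨P', Q', R'⟩ - h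
      simp only [Prod.mk.injEq] at h ⊢
      tauto
  rw [← Finset.card_filter_add_card_filter_not (s := reducedTriples d) (fun t => t.2.1 ≤ t.2.2)]
  omega

/-- Consecutive odd and even terms are paired; each later pair is at most 1/(k+1) - 1/(k+2), which
telescopes. -/
lemma sum_gcd_two_div_sq_le (K : ℕ) :
    ∑ e ∈ Finset.Icc 1 K, (Nat.gcd e 2 : ℝ) / (e : ℝ) ^ 2 ≤ 5 / 2 := by
  have hdouble : ∀ k : ℕ, ∑ e ∈ Finset.Icc 1 (2 * (k + 1)), (Nat.gcd e 2 : ℝ) / (e : ℝ) ^ 2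
      ≤ 5 / 2 - 1 / ((k : ℝ) + 1) := by
    intro k
    induction k with
    | zero =>
      rw [show 2 * (0 + 1) = 1 + 1 by rfl, Finset.sum_Icc_succ_top (by omega), Finset.Icc_self,
        Finset.sum_singleton]
      norm_num
    | succ k ih =>
      rw [show 2 * (k + 1 + 1) = 2 * (k + 1) + 1 + 1 by ring, Finset.sum_Icc_succ_top (by omega),
        Finset.sum_Icc_succ_top (by omega)]
      have h1 : Nat.gcd (2 * (k + 1) + 1) 2 = 1 := by simp
      have h2 : Nat.gcd (2 * (k + 1) + 1 + 1) 2 = 2 :=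
        Nat.gcd_eq_right ⟨k + 1 + 1, by ring⟩
      rw [h1, h2]
      push_cast
      have hk : (0 : ℝ) ≤ k := Nat.cast_nonneg k
      have h3 : (1 : ℝ) / (2 * (k + 1) + 1) ^ 2 ≤ 1 / (4 * ((k + 1) * (k + 1 + 1))) :=
        one_div_le_one_div_of_le (by positivity) (by nlinarith)
      have h4 : (2 : ℝ) / (2 * (k + 1) + 1 + 1) ^ 2 ≤ 1 / (2 * ((k + 1) * (k + 1 + 1))) := by
        rw [div_le_div_iff₀ (by positivity) (by positivity)]
        nlinarith
      have h5 : (1 : ℝ) / (k + 1) - 1 / (k + 1 + 1) = 1 / ((k + 1) * (k + 1 + 1)) := by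
        field_simp; ring
      have h6 : (1 : ℝ) / (4 * ((k + 1) * (k + 1 + 1))) + 1 / (2 * ((k + 1) * (k + 1 + 1)))
          ≤ 1 / ((k + 1) * (k + 1 + 1)) := by
        have : (0 : ℝ) ≤ 1 / ((k + 1) * (k + 1 + 1)) := by positivity
        generalize ((k : ℝ) + 1) * (k + 1 + 1) = z at this ⊢
        rw [show 1 / (4 * z) = 1 / 4 * (1 / z) by ring, show 1 / (2 * z) = 1 / 2 * (1 / z) by ring]
        linarith
      linarith
  refine le_trans ?_ ((hdouble K).trans (sub_le_self _ (by positivity)))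
  refine Finset.sum_le_sum_of_subset_of_nonneg (Finset.Icc_subset_Icc_right (by omega))
    fun _ _ _ => by positivity

/-- After exchanging sums, each e contributes gcd(e, 2)·⌊K/e⌋². -/
lemma sum_sum_sum_divisors_gcd_le (K : ℕ) :
    ((∑ A ∈ Finset.Icc 1 K, ∑ B ∈ Finset.Icc 1 K,
      ∑ e ∈ (Nat.gcd A B).divisors, Nat.gcd e 2 : ℕ) : ℝ) ≤ 5 / 2 * (K : ℝ) ^ 2 := by
  have h1 : ∀ A ∈ Finset.Icc 1 K, ∀ B ∈ Finset.Icc 1 K,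
      ∑ e ∈ (Nat.gcd A B).divisors, Nat.gcd e 2
        = ∑ e ∈ Finset.Icc 1 K, (if e ∣ A then 1 else 0) * (if e ∣ B then 1 else 0)
          * Nat.gcd e 2 := by
    intro A hA B hB
    rw [Finset.mem_Icc] at hA hB
    have : (Nat.gcd A B).divisors = (Finset.Icc 1 K).filter fun e => e ∣ A ∧ e ∣ B := by
      ext e
      simp only [Nat.mem_divisors, Nat.dvd_gcd_iff, Finset.mem_filter, Finset.mem_Icc]
      constructor
      · rintro ⟨⟨hA', hB'⟩, -⟩
        exact ⟨⟨Nat.pos_of_dvd_of_pos hA' hA.1, (Nat.le_of_dvd hA.1 hA').trans hA.2⟩, hA', hB'⟩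
      · rintro ⟨-, h⟩
        exact ⟨h, (Nat.gcd_pos_of_pos_left _ hA.1).ne'⟩
    rw [this, Finset.sum_filter]
    refine Finset.sum_congr rfl fun e _ => ?_
    by_cases hA' : e ∣ A <;> by_cases hB' : e ∣ B <;> simp [hA', hB']
  have h2 : ∀ e ∈ Finset.Icc 1 K, ∑ A ∈ Finset.Icc 1 K, (if e ∣ A then 1 else 0) = K / e := by
    intro e _
    rw [← Finset.card_filter]
    exact Nat.Ioc_filter_dvd_card_eq_div K e
  have h3 : ∑ A ∈ Finset.Icc 1 K, ∑ B ∈ Finset.Icc 1 K,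
      ∑ e ∈ (Nat.gcd A B).divisors, Nat.gcd e 2
        = ∑ e ∈ Finset.Icc 1 K, (K / e) * (K / e) * Nat.gcd e 2 := by
    rw [Finset.sum_congr rfl fun A hA => Finset.sum_congr rfl fun B hB => h1 A hA B hB]
    simp_rw [Finset.sum_comm (s := Finset.Icc 1 K) (t := Finset.Icc 1 K)
      (f := fun B e => _ * _ * Nat.gcd e 2)]
    rw [Finset.sum_comm]
    refine Finset.sum_congr rfl fun e he => ?_
    rw [← h2 e he, Finset.sum_mul_sum, Finset.sum_mul]
    exact Finset.sum_congr rfl fun A _ => (Finset.sum_mul ..).symm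
  rw [h3]
  push_cast
  calc _ ≤ ∑ e ∈ Finset.Icc 1 K, (K : ℝ) ^ 2 * ((Nat.gcd e 2 : ℝ) / (e : ℝ) ^ 2) := by
        refine Finset.sum_le_sum fun e _ => ?_
        have : ((K / e : ℕ) : ℝ) ≤ (K : ℝ) / e := Nat.cast_div_le
        calc ((K / e : ℕ) : ℝ) * ((K / e : ℕ) : ℝ) * (Nat.gcd e 2 : ℝ)
            ≤ ((K : ℝ) / e) * ((K : ℝ) / e) * (Nat.gcd e 2 : ℝ) := by gcongr
          _ = _ := by ring
    _ ≤ _ := by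
        rw [← Finset.mul_sum]
        nlinarith [sum_gcd_two_div_sq_le K, sq_nonneg (K : ℝ)]

theorem sum_sqrtPeriod_sq_le (X : ℕ) :
    ∑ d ∈ Finset.Icc 1 X, (sqrtPeriod d : ℝ) ^ 2 ≤ 10 * (X : ℝ) ^ 2 := by
  set K := Nat.sqrt X with hK
  have h1 : ∑ d ∈ Finset.Icc 1 X, sqrtPeriod d ^ 2
      ≤ 4 * (X * ∑ A ∈ Finset.Icc 1 K, ∑ B ∈ Finset.Icc 1 K,
          ∑ e ∈ (Nat.gcd A B).divisors, Nat.gcd e 2) := by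
    calc ∑ d ∈ Finset.Icc 1 X, sqrtPeriod d ^ 2
        ≤ ∑ d ∈ Finset.Icc 1 X, 4 * ∑ A ∈ Finset.Icc 1 K, ∑ B ∈ Finset.Icc 1 K,
            (modRoots A d).card * (modRoots B d).card := by
          refine Finset.sum_le_sum fun d hd => ?_
          rw [← Finset.sum_mul_sum]
          have := (sqrtPeriod_le_card_reducedTriples d).trans
            (card_reducedTriples_le (Finset.mem_Icc.1 hd).2)
          calc sqrtPeriod d ^ 2 ≤ (2 * ∑ Q ∈ Finset.Icc 1 K, (modRoots Q d).card) ^ 2 :=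
                Nat.pow_le_pow_left this 2
            _ = _ := by ring
      _ = 4 * ∑ A ∈ Finset.Icc 1 K, ∑ B ∈ Finset.Icc 1 K, ∑ d ∈ Finset.Icc 1 X,
            (modRoots A d).card * (modRoots B d).card := by
          rw [← Finset.mul_sum, Finset.sum_comm]
          congr 1
          exact Finset.sum_congr rfl fun A _ => Finset.sum_comm
      _ ≤ _ := by
          rw [Finset.mul_sum (a := X)]
          refine Nat.mul_le_mul_left 4 (Finset.sum_le_sum fun A hA => ?_)
          rw [Finset.mul_sum]
          exact Finset.sum_le_sum fun B hB => sum_card_modRoots_mul_le X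
            (Finset.mem_Icc.1 hA).1 (Finset.mem_Icc.1 hB).1
  have h2 := sum_sum_sum_divisors_gcd_le K
  have h3 : ((K : ℝ)) ^ 2 ≤ X := by exact_mod_cast Nat.sqrt_le' X
  have h4 : (∑ d ∈ Finset.Icc 1 X, (sqrtPeriod d : ℝ) ^ 2)
      ≤ 4 * (X * ((∑ A ∈ Finset.Icc 1 K, ∑ B ∈ Finset.Icc 1 K,
          ∑ e ∈ (Nat.gcd A B).divisors, Nat.gcd e 2 : ℕ) : ℝ)) := by exact_mod_cast h1
  refine h4.trans ?_
  have hX : (0 : ℝ) ≤ X := Nat.cast_nonneg X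
  calc _ ≤ 4 * ((X : ℝ) * (5 / 2 * (X : ℝ))) := by
        gcongr
        exact h2.trans (by linarith)
    _ = _ := by ring

/-! ### Numerical constants and conclusion -/

lemma sum_card_reducedTriples_le_of_one_le {r : ℝ} (hr : 1 ≤ r) :
    ∑ d ∈ Finset.Icc 1 ⌊r ^ 2⌋₊, ((reducedTriples d).card : ℝ) ≤ 924 / 1000 * r ^ 3 := by
  rcases le_or_gt 4 r with h4 | h4
  · exact sum_card_reducedTriples_le_of_four_le h4
  have hr0 : 0 ≤ r := by linarith
  have hk : ⌊r ^ 2⌋₊ ≤ 15 := by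
    have : ⌊r ^ 2⌋₊ < 16 := (Nat.floor_lt (by positivity)).2 (by push_cast; nlinarith)
    omega
  have h1 := sum_card_reducedTriples_sq_le hk
  have h2 : 1000 * (∑ d ∈ Finset.Icc 1 ⌊r ^ 2⌋₊, ((reducedTriples d).card : ℝ)) ^ 2
      ≤ 853 * (⌊r ^ 2⌋₊ : ℝ) ^ 3 := by exact_mod_cast h1
  have h3 : (⌊r ^ 2⌋₊ : ℝ) ^ 3 ≤ (r ^ 2) ^ 3 :=
    pow_le_pow_left₀ (Nat.cast_nonneg _) (Nat.floor_le (by positivity)) 3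
  refine (pow_le_pow_iff_left₀ (by positivity) (by positivity) two_ne_zero).1 ?_
  have h4 : 0 ≤ r ^ 6 := by positivity
  nlinarith

lemma rpow_three_halves {x : ℝ} (hx : 0 ≤ x) : x ^ (3 / 2 : ℝ) = Real.sqrt x ^ 3 := by
  rw [Real.sqrt_eq_rpow, ← Real.rpow_natCast, ← Real.rpow_mul hx]
  norm_num

lemma sum_Ioc_sqrtPeriod_le {r : ℝ} (hr : 1 ≤ r) :
    ∑ d ∈ Finset.Ioc ⌊r ^ 2⌋₊ ⌊2 * r ^ 2⌋₊, (sqrtPeriod d : ℝ)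
      ≤ ((8 * Real.sqrt 2 - 4) / 3 * Real.log 2) * r ^ 3 + 2000 * r := by
  have hr0 : 0 < r := by linarith
  have hs2 : Real.sqrt 2 ^ 2 = 2 := Real.sq_sqrt (by norm_num)
  have hs : 1.414 ≤ Real.sqrt 2 := Real.le_sqrt_of_sq_le (by norm_num)
  have hsplit := Finset.sum_Ioc_consecutive (fun d => ((reducedTriples d).card : ℝ))
    (Nat.zero_le ⌊r ^ 2⌋₊) (Nat.floor_le_floor (show r ^ 2 ≤ 2 * r ^ 2 by nlinarith))
  have hlow := le_sum_card_reducedTriples hr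
  have hup := sum_card_reducedTriples_le_asymptotic (r := Real.sqrt 2 * r) (by nlinarith)
  have e2 : (Real.sqrt 2 * r) ^ 2 = 2 * r ^ 2 := by rw [mul_pow, hs2]
  have e3 : (Real.sqrt 2 * r) ^ 3 = 2 * Real.sqrt 2 * r ^ 3 := by
    rw [mul_pow, pow_succ, hs2]
  rw [e2, e3] at hup
  have hle : ∑ d ∈ Finset.Ioc ⌊r ^ 2⌋₊ ⌊2 * r ^ 2⌋₊, (sqrtPeriod d : ℝ)
      ≤ ∑ d ∈ Finset.Ioc ⌊r ^ 2⌋₊ ⌊2 * r ^ 2⌋₊, ((reducedTriples d).card : ℝ) :=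
    Finset.sum_le_sum fun d _ => by exact_mod_cast sqrtPeriod_le_card_reducedTriples d
  have hIcc : ∀ n, Finset.Icc 1 n = Finset.Ioc 0 n := fun _ => rfl
  rw [hIcc] at hlow hup
  have hlog : 0.6931 ≤ Real.log 2 := by linarith [Real.log_two_gt_d9]
  -- The count has leading coefficient 25/32·(√2)³ - 5/8, which leaves a surplus of r³/10.
  have hc : 25 / 16 * Real.sqrt 2 - 5 / 8 + 1 / 10 ≤ (8 * Real.sqrt 2 - 4) / 3 * Real.log 2 := by
    nlinarith
  have hc3 := mul_le_mul_of_nonneg_right hc (pow_pos hr0 3).le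
  -- The error 26r² is absorbed by r³/10 + 1690r, since r(r - 130)²/10 ≥ 0; hence O(r) = O(√x).
  nlinarith [mul_nonneg hr0.le (sq_nonneg (r - 130))]

theorem corollary1 :
    (∀ x : ℝ, 1 < x →
      (∑ d ∈ Finset.Icc 1 ⌊x⌋₊, (sqrtPeriod d : ℝ))
          ≤ (4 / 3 * Real.log 2) * x ^ (3 / 2 : ℝ) ∧
      (∑ d ∈ Finset.Icc 1 ⌊x⌋₊, (sqrtPeriod d : ℝ) ^ 2)
          ≤ 11.9 * x ^ 2
            + 5 * x ^ (3 / 2 : ℝ) * (Real.log (4 * Real.exp 4 * x)) ^ 2) ∧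
    (∃ E : ℝ → ℝ, E =O[atTop] (fun x : ℝ => Real.sqrt x) ∧
      ∀ x : ℝ, 1 < x →
        (∑ d ∈ Finset.Ioc ⌊x⌋₊ ⌊2 * x⌋₊, (sqrtPeriod d : ℝ))
          ≤ ((8 * Real.sqrt 2 - 4) / 3 * Real.log 2) * x ^ (3 / 2 : ℝ) + E x) ∧
    (∃ E : ℝ → ℝ, E =O[atTop] (fun x : ℝ => x ^ (3 / 2 : ℝ) * (Real.log x) ^ 2) ∧
      ∀ x : ℝ, 1 < x →
        (∑ d ∈ Finset.Ioc ⌊x⌋₊ ⌊2 * x⌋₊, (sqrtPeriod d : ℝ) ^ 2)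
          ≤ 47 * x ^ 2 + E x) := by
  -- The constant 10 beats 11.9 outright, and 10·(2x)² = 40x² beats 47x², so the last error term can
  -- be 0.
  have hsq : ∀ x : ℝ, 0 ≤ x →
      ∑ d ∈ Finset.Icc 1 ⌊x⌋₊, (sqrtPeriod d : ℝ) ^ 2 ≤ 10 * x ^ 2 := fun x hx =>
    (sum_sqrtPeriod_sq_le _).trans (by gcongr; exact Nat.floor_le hx)
  refine ⟨fun x hx => ⟨?_, ?_⟩, ⟨fun x => 2000 * Real.sqrt x, ?_, fun x hx => ?_⟩,
    ⟨fun _ => 0, isBigO_zero _ _, fun x hx => ?_⟩⟩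
  · have hx0 : 0 ≤ x := by linarith
    have hr1 : 1 ≤ Real.sqrt x := Real.one_le_sqrt.2 hx.le
    have h := sum_card_reducedTriples_le_of_one_le hr1
    rw [Real.sq_sqrt hx0] at h
    rw [rpow_three_halves hx0]
    refine (Finset.sum_le_sum fun d _ => ?_).trans (h.trans ?_)
    · exact_mod_cast sqrtPeriod_le_card_reducedTriples d
    · gcongr
      linarith [Real.log_two_gt_d9]
  · have hx0 : 0 ≤ x := by linarith
    have h1 : 0 ≤ 5 * x ^ (3 / 2 : ℝ) * (Real.log (4 * Real.exp 4 * x)) ^ 2 := by positivity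
    nlinarith [hsq x hx0, sq_nonneg x]
  · exact (isBigO_refl _ _).const_mul_left 2000
  · have hx0 : 0 ≤ x := by linarith
    have h := sum_Ioc_sqrtPeriod_le (Real.one_le_sqrt.2 hx.le)
    rwa [Real.sq_sqrt hx0, ← rpow_three_halves hx0] at h
  · have hsub : Finset.Ioc ⌊x⌋₊ ⌊2 * x⌋₊ ⊆ Finset.Icc 1 ⌊2 * x⌋₊ := fun d hd => by
      rw [Finset.mem_Ioc] at hd
      exact Finset.mem_Icc.2 ⟨by omega, hd.2⟩
    have h := (Finset.sum_le_sum_of_subset_of_nonneg hsub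
      fun d _ _ => sq_nonneg (sqrtPeriod d : ℝ)).trans (hsq (2 * x) (by linarith))
    nlinarith [sq_nonneg x]
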